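/- Let $\mu>0$ and consider the system $z(k)=A(k)\otimes z(k-1)$, $k\ge 1$, with $z(k)=(x(k),y(k))^{T}\in\mathbb{R}^2$ and $z(0)=(0,0)^{T}$, where $\otimes$ is the matrix-vector product over the semiring of real numbers with maximum as addition and ordinary addition as multiplication. That is, for $A(k)=\begin{pmatrix} a_k & b_k\\ c_k & d_k\end{pmatrix}$, $$x(k)=\max(x(k-1)+a_k,\;y(k-1)+b_k),\qquad y(k)=\max(x(k-1)+c_k,\;y(k-1)+d_k).$$ The Lyapunov exponent of the system is the almost sure limit $\lambda=\lim_{k\to\infty}\frac1k\max(x(k),y(k))$. (1) Let $\nu>0$ and let $\alpha_1,\alpha_2,\dots,\beta_1,\beta_2,\dots$ be mutually independent random variables, with each $\alpha_k$ exponentially distributed with parameter (rate) $\mu$ and each $\beta_k$ exponentially distributed with parameter $\nu$. If $A(k)=\begin{pmatrix}\alpha_k&\beta_k\\0&0\end{pmatrix}$ (the entries $0$ being the real number zero), then the Lyapunov exponent exists and equals $$\lambda=\frac{2\mu^{4}+7\mu^{3}\nu+10\mu^{2}\nu^{2}+11\mu\nu^{3}+4\nu^{4}}{\mu\nu(\mu+\nu)^{2}(3\mu+4\nu)}.$$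 (2) Let $\sigma>0$ and let $\alpha_1,\alpha_2,\dots,\gamma_1,\gamma_2,\dots$ be mutually independent random variables, with each $\alpha_k$ exponentially distributed with parameter $\mu$ and each $\gamma_k$ exponentially distributed with parameter $\sigma$. If $A(k)=\begin{pmatrix}\alpha_k&0\\\gamma_k&0\end{pmatrix}$, then the Lyapunov exponent exists and equals $$\lambda=\frac{2\mu^{4}+7\mu^{3}\sigma+10\mu^{2}\sigma^{2}+11\mu\sigma^{3}+4\sigma^{4}}{\mu\sigma(\mu+\sigma)^{2}(3\mu+4\sigma)}.$$ -/

import Mathlib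

open MeasureTheory ProbabilityTheory Filter Topology

/-- Matrix-vector product for second-order matrices over the semiring of real numbers with
maximum as addition and ordinary addition as multiplication. -/
noncomputable def maxPlusMulVec (A : Matrix (Fin 2) (Fin 2) ℝ) (z : Fin 2 → ℝ) : Fin 2 → ℝ :=
  fun i => max (z 0 + A i 0) (z 1 + A i 1)

/-- The state vector `z(k)` of the system `z(k) = A(k) z(k-1)`, `z(0) = (0, 0)`, driven by a
sequence of random matrices. Sequences are indexed from zero here: `A k` is the transition
matrix of step `k + 1`. -/
noncomputable def stateVector {Ω : Type*} (A : ℕ → Ω → Matrix (Fin 2) (Fin 2) ℝ) :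
    ℕ → Ω → Fin 2 → ℝ
  | 0, _ => 0
  | k + 1, ω => maxPlusMulVec (A k ω) (stateVector A k ω)

/-- `lam` is the Lyapunov exponent of the system driven by `A`: with probability one,
`(1 / k) max (x(k), y(k))` converges to `lam`, where `z(k) = (x(k), y(k))`. -/
def IsLyapunovExponent {Ω : Type*} [MeasurableSpace Ω] (P : Measure Ω)
    (A : ℕ → Ω → Matrix (Fin 2) (Fin 2) ℝ) (lam : ℝ) : Prop :=
  ∀ᵐ ω ∂P, Tendsto
    (fun k : ℕ => (1 / (k : ℝ)) * max (stateVector A k ω 0) (stateVector A k ω 1))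
    atTop (𝓝 lam)

/-! Both systems reduce to one scalar recursion `D (n + 1) = max (a n) (b n - D n)` with fresh
independent exponential inputs. For the first matrix `D n` is the gap `x(n) - y(n)`, which equals
`x(n) - x(n-1)` for `n ≥ 1`; for the second it is `x(n+1) - x(n)`, so `α` is read one step later. In
either case the partial sums of `D` are `x` up to a bounded shift, and the exponent is the limiting
average of `D`.

That average comes from a Poisson equation. By memorylessness, the mean of `D' + θ exp(-ν D')` after
one step from `d` is affine in `exp(-ν d)` (`integral_integral_max_expMeasure`). Choosing `θ` to
reproduce itself as the coefficient leaves `lam` as the constant. Then `∑ D - n lam + θ exp(-ν D n)`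
has orthogonal increments dominated in L², so its second moment grows linearly
(`integral_sq_le_of_centered_increments`). Divided by `n`, it vanishes along squares, and
monotonicity of the sums of `D ≥ 0` fills the gaps. -/

/-! ### Integrals against the exponential law and the one-step mean. -/

theorem integral_expMeasure {r : ℝ} (hr : 0 < r) (g : ℝ → ℝ) :
    ∫ x, g x ∂(expMeasure r) = ∫ x in Set.Ioi 0, r * Real.exp (-(r * x)) * g x := by
  have h1 : expMeasure r = volume.withDensity (exponentialPDF r) := rfl
  have hm : Measurable (exponentialPDF r) :=
    (measurable_exponentialPDFReal r).ennreal_ofReal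
  rw [h1, integral_withDensity_eq_integral_toReal_smul hm (ae_of_all _ fun x => by
    simp [exponentialPDF]), ← integral_Ici_eq_integral_Ioi, ← integral_indicator measurableSet_Ici]
  congr 1
  ext x
  by_cases hx : 0 ≤ x
  · rw [Set.indicator_of_mem (by simpa using hx), exponentialPDF_of_nonneg hx,
      ENNReal.toReal_ofReal (by positivity), smul_eq_mul]
  · rw [Set.indicator_of_notMem (by simpa using hx), exponentialPDF_of_neg (by linarith)]
    simp

theorem integrable_expMeasure_iff {r : ℝ} (hr : 0 < r) (g : ℝ → ℝ) :
    Integrable g (expMeasure r) ↔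
      IntegrableOn (fun x => r * Real.exp (-(r * x)) * g x) (Set.Ioi 0) := by
  have h1 : expMeasure r = volume.withDensity (exponentialPDF r) := rfl
  have hm : Measurable (exponentialPDF r) :=
    (measurable_exponentialPDFReal r).ennreal_ofReal
  rw [h1, integrable_withDensity_iff_integrable_smul' hm (ae_of_all _ fun x => by
    simp [exponentialPDF]), ← integrableOn_Ici_iff_integrableOn_Ioi,
    ← integrable_indicator_iff measurableSet_Ici]
  refine integrable_congr (ae_of_all _ fun x => ?_)
  by_cases hx : 0 ≤ x
  · simp only [Set.indicator_of_mem (show x ∈ Set.Ici 0 from hx)]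
    rw [exponentialPDF_of_nonneg hx, ENNReal.toReal_ofReal (by positivity), smul_eq_mul]
  · simp only [Set.indicator_of_notMem (show x ∉ Set.Ici 0 from hx)]
    rw [exponentialPDF_of_neg (by linarith)]
    simp

theorem ae_nonneg_expMeasure (r : ℝ) : ∀ᵐ x ∂(expMeasure r), 0 ≤ x := by
  have h1 : expMeasure r = volume.withDensity (exponentialPDF r) := rfl
  have hm : Measurable (exponentialPDF r) :=
    (measurable_exponentialPDFReal r).ennreal_ofReal
  rw [h1, ae_withDensity_iff hm]
  refine ae_of_all _ fun x hx => ?_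
  by_contra h
  exact hx (exponentialPDF_of_neg (by linarith))

/-- Memorylessness of the exponential distribution. -/
theorem integral_expMeasure_excess {r : ℝ} (hr : 0 < r) {g : ℝ → ℝ} (hg : g 0 = 0) {s : ℝ}
    (hs : 0 ≤ s) :
    ∫ x, g (max (x - s) 0) ∂(expMeasure r) =
      Real.exp (-(r * s)) * ∫ x, g x ∂(expMeasure r) := by
  rw [integral_expMeasure hr, integral_expMeasure hr, ← integral_const_mul]
  -- Below `s` the excess is zero and `g 0 = 0`; translating the rest by `s` releases the factor
  -- `exp(-(r * s))`.
  have h1 : ∫ x in Set.Ioi 0, r * Real.exp (-(r * x)) * g (max (x - s) 0) =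
      ∫ x in Set.Ioi s, r * Real.exp (-(r * x)) * g (max (x - s) 0) := by
    refine setIntegral_eq_of_subset_of_forall_sdiff_eq_zero measurableSet_Ioi
      (Set.Ioi_subset_Ioi hs) fun x hx => ?_
    have : x ≤ s := by simpa using hx.2
    rw [max_eq_right (by linarith), hg, mul_zero]
  have h2 := (measurePreserving_add_right volume s).setIntegral_preimage_emb
    (measurableEmbedding_addRight s)
    (fun x => r * Real.exp (-(r * x)) * g (max (x - s) 0)) (Set.Ioi s)
  rw [h1, ← h2, Set.preimage_add_const_Ioi, sub_self]
  refine setIntegral_congr_fun measurableSet_Ioi fun x hx => ?_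
  have hx : 0 < x := hx
  simp only [add_sub_cancel_right, max_eq_left hx.le, mul_add, neg_add, Real.exp_add]
  ring

theorem integral_exp_expMeasure {r κ : ℝ} (hr : 0 < r) (hκ : 0 ≤ κ) :
    ∫ x, Real.exp (-(κ * x)) ∂(expMeasure r) = r / (r + κ) := by
  rw [integral_expMeasure hr]
  have : ∀ x : ℝ, r * Real.exp (-(r * x)) * Real.exp (-(κ * x)) =
      r * Real.exp (-(r + κ) * x) := fun x => by
    rw [mul_assoc, ← Real.exp_add]; ring_nf
  simp_rw [this]
  rw [integral_const_mul, integral_exp_mul_Ioi (by linarith), mul_zero, Real.exp_zero, neg_div_neg_eq]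
  ring

theorem integral_id_expMeasure {r : ℝ} (hr : 0 < r) : ∫ x, x ∂(expMeasure r) = 1 / r := by
  rw [integral_expMeasure hr]
  have h := Real.integral_rpow_mul_exp_neg_mul_Ioi (a := 2) (by norm_num) hr
  have : ∀ x : ℝ, r * Real.exp (-(r * x)) * x =
      r * (x ^ ((2 : ℝ) - 1) * Real.exp (-(r * x))) := fun x => by
    norm_num; ring
  simp_rw [this]
  rw [integral_const_mul, h, Real.Gamma_two]
  simp
  field_simp

theorem memLp_two_id_expMeasure {r : ℝ} (hr : 0 < r) : MemLp (fun x : ℝ => x) 2 (expMeasure r) := by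
  rw [memLp_two_iff_integrable_sq (by fun_prop), integrable_expMeasure_iff hr]
  have h := integrableOn_rpow_mul_exp_neg_mul_rpow (s := 2) (p := 1) (by norm_num) (by norm_num) hr
  refine (h.const_mul r).congr (ae_of_all _ fun x => ?_)
  simp
  ring

theorem integrable_exp_expMeasure {r κ : ℝ} (hr : 0 < r) (hκ : 0 ≤ κ) :
    Integrable (fun x => Real.exp (-(κ * x))) (expMeasure r) := by
  have := isProbabilityMeasure_expMeasure hr
  refine Integrable.of_bound (by fun_prop) 1 ?_
  filter_upwards [ae_nonneg_expMeasure r] with x hx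
  rw [Real.norm_eq_abs, abs_of_nonneg (Real.exp_nonneg _)]
  exact Real.exp_le_one_iff.2 (by nlinarith [mul_nonneg hκ hx])

/-- With `u` the excess of `b` over `a + d`, the maximum is `a + u`, so memorylessness evaluates the
mean over `b`. -/
theorem integral_max_expMeasure {ν θ : ℝ} (hν : 0 < ν) {a d : ℝ} (ha : 0 ≤ a) (hd : 0 ≤ d) :
    ∫ b, (max a (b - d) + θ * Real.exp (-(ν * max a (b - d)))) ∂(expMeasure ν) =
      a + Real.exp (-(ν * (a + d))) / ν +
        θ * (Real.exp (-(ν * a)) - Real.exp (-(ν * a)) * Real.exp (-(ν * (a + d))) / 2) := by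
  have := isProbabilityMeasure_expMeasure hν
  have hid : Integrable (fun x : ℝ => x) (expMeasure ν) :=
    (memLp_two_id_expMeasure hν).integrable (by norm_num)
  have hex := integrable_exp_expMeasure hν hν.le
  -- The part depending on the excess `u`, normalised to vanish at `u = 0` as
  -- `integral_expMeasure_excess` requires.
  set g : ℝ → ℝ := fun u => u - θ * Real.exp (-(ν * a)) * (1 - Real.exp (-(ν * u))) with hg
  have h0 : g 0 = 0 := by simp [hg]
  have hpt : ∀ b : ℝ, max a (b - d) + θ * Real.exp (-(ν * max a (b - d))) =
      (a + θ * Real.exp (-(ν * a))) + g (max (b - (a + d)) 0) := fun b => by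
    have h1 : max a (b - d) = a + max (b - (a + d)) 0 := by
      rw [← max_add_add_left, max_comm]; ring_nf
    rw [h1, hg]
    simp only [mul_add, neg_add, Real.exp_add]
    ring
  have hint : Integrable (fun b => g (max (b - (a + d)) 0)) (expMeasure ν) := by
    have h1 : Integrable (fun b => max (b - (a + d)) 0) (expMeasure ν) :=
      (hid.sub (integrable_const (a + d))).pos_part
    refine h1.sub (Integrable.const_mul (Integrable.sub (integrable_const _) ?_) _)
    refine Integrable.of_bound (by fun_prop) 1 (ae_of_all _ fun x => ?_)
    rw [Real.norm_eq_abs, abs_of_nonneg (Real.exp_nonneg _)]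
    exact Real.exp_le_one_iff.2 (by
      have := mul_nonneg hν.le (le_max_right (x - (a + d)) 0); linarith)
  simp_rw [hpt]
  rw [integral_add (integrable_const _) hint, integral_expMeasure_excess hν h0 (by positivity)]
  have hgi : ∫ x, g x ∂(expMeasure ν) = 1 / ν - θ * Real.exp (-(ν * a)) * (1 / 2) := by
    simp only [hg]
    rw [integral_sub hid, integral_const_mul, integral_sub (integrable_const _) hex,
      integral_id_expMeasure hν, integral_exp_expMeasure hν hν.le]
    · have : ν / (ν + ν) = 1 / 2 := by field_simp; norm_num
      rw [this]
      simp
      norm_num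
    · exact ((integrable_const _).sub hex).const_mul _
  rw [hgi]
  simp
  ring

/-- The initial gap `d` survives only through `exp(-(ν * d))`, the same exponential as in the
integrand: this closure makes the Poisson equation solvable. -/
theorem integral_integral_max_expMeasure {μ ν θ : ℝ} (hμ : 0 < μ) (hν : 0 < ν) {d : ℝ}
    (hd : 0 ≤ d) :
    ∫ a, ∫ b, (max a (b - d) + θ * Real.exp (-(ν * max a (b - d)))) ∂(expMeasure ν)
        ∂(expMeasure μ) =
      1 / μ + θ * (μ / (μ + ν)) +
        (μ / (ν * (μ + ν)) - θ * μ / (2 * (μ + 2 * ν))) * Real.exp (-(ν * d)) := by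
  have := isProbabilityMeasure_expMeasure hμ
  have hid : Integrable (fun x : ℝ => x) (expMeasure μ) :=
    (memLp_two_id_expMeasure hμ).integrable (by norm_num)
  have h1 := integrable_exp_expMeasure hμ hν.le
  have h2 := integrable_exp_expMeasure hμ (show 0 ≤ 2 * ν by positivity)
  have hae : ∀ᵐ a ∂(expMeasure μ),
      ∫ b, (max a (b - d) + θ * Real.exp (-(ν * max a (b - d)))) ∂(expMeasure ν) =
      (a + (Real.exp (-(ν * d)) / ν + θ) * Real.exp (-(ν * a))) -
        θ * Real.exp (-(ν * d)) / 2 * Real.exp (-(2 * ν * a)) := by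
    filter_upwards [ae_nonneg_expMeasure μ] with a ha
    rw [integral_max_expMeasure hν ha hd]
    have e1 : Real.exp (-(2 * ν * a)) = Real.exp (-(ν * a)) * Real.exp (-(ν * a)) := by
      rw [← Real.exp_add]; ring_nf
    rw [e1, mul_add, neg_add, Real.exp_add]
    ring
  have h3 : Integrable (fun a => a + (Real.exp (-(ν * d)) / ν + θ) * Real.exp (-(ν * a)))
      (expMeasure μ) := hid.add (h1.const_mul _)
  rw [integral_congr_ae hae, integral_sub h3 (h2.const_mul _),
    integral_add hid (h1.const_mul _), integral_const_mul, integral_const_mul,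
    integral_id_expMeasure hμ, integral_exp_expMeasure hμ hν.le,
    integral_exp_expMeasure hμ (by positivity)]
  field_simp
  ring

/-! ### Strong law from second moments. -/

/-- Second moments growing at most linearly force convergence to zero of `S n / n` along
squares. -/
theorem ae_tendsto_div_sq_of_integral_sq_le {Ω : Type*} [MeasurableSpace Ω] {P : Measure Ω}
    {S : ℕ → Ω → ℝ} (hS : ∀ n, MemLp (S n) 2 P) {C : ℝ}
    (hC : ∀ n, ∫ ω, S n ω ^ 2 ∂P ≤ C * (n + 1)) :
    ∀ᵐ ω ∂P, Tendsto (fun k : ℕ => S ((k + 1) ^ 2) ω / (((k + 1) ^ 2 : ℕ) : ℝ)) atTop (𝓝 0) := by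
  have hC0 : 0 ≤ C := by
    have := (integral_nonneg fun ω => sq_nonneg (S 0 ω)).trans (hC 0)
    simpa using this
  set f : ℕ → Ω → ℝ := fun k ω => (S ((k + 1) ^ 2) ω / (((k + 1) ^ 2 : ℕ) : ℝ)) ^ 2 with hf
  have hfi : ∀ k, Integrable (f k) P := fun k => by
    simp only [hf, div_pow]
    exact (hS _).integrable_sq.div_const _
  have hb : ∀ k, ∫ ω, f k ω ∂P ≤ 2 * C * (1 / ((k + 1 : ℕ) : ℝ) ^ 2) := fun k => by
    simp only [hf, div_pow]
    rw [integral_div]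
    have hk : (1 : ℝ) ≤ ((k + 1 : ℕ) : ℝ) := by push_cast; linarith [k.cast_nonneg (α := ℝ)]
    have hk2 : (0 : ℝ) < ((k + 1 : ℕ) : ℝ) := by linarith
    have h1 := hC ((k + 1) ^ 2)
    rw [div_le_iff₀ (by positivity)]
    refine h1.trans ?_
    rw [Nat.cast_pow]
    have h2 : 2 * C * (1 / ((k + 1 : ℕ) : ℝ) ^ 2) * ((((k + 1 : ℕ) : ℝ) ^ 2) ^ 2) =
        C * (2 * ((k + 1 : ℕ) : ℝ) ^ 2) := by field_simp
    rw [h2]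
    gcongr
    nlinarith
  have hsum : Summable fun k : ℕ => 2 * C * (1 / ((k + 1 : ℕ) : ℝ) ^ 2) :=
    (((summable_nat_add_iff 1).2 (Real.summable_one_div_nat_pow.2 one_lt_two))).mul_left _
  -- A series of squares with finite expectation converges almost surely, so its terms tend to zero.
  have hlt : ∫⁻ ω, ∑' k, ENNReal.ofReal (f k ω) ∂P ≠ ⊤ := by
    rw [lintegral_tsum fun k => (hfi k).aemeasurable.ennreal_ofReal]
    have h3 : ∀ k, ∫⁻ ω, ENNReal.ofReal (f k ω) ∂P ≤
        ENNReal.ofReal (2 * C * (1 / ((k + 1 : ℕ) : ℝ) ^ 2)) := fun k => by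
      rw [← ofReal_integral_eq_lintegral_ofReal (hfi k) (ae_of_all _ fun ω => sq_nonneg _)]
      exact ENNReal.ofReal_le_ofReal (hb k)
    refine ne_top_of_le_ne_top ?_ (ENNReal.tsum_le_tsum h3)
    rw [← ENNReal.ofReal_tsum_of_nonneg (fun k => by positivity) hsum]
    exact ENNReal.ofReal_ne_top
  have hae := ae_lt_top' (AEMeasurable.tsum fun k =>
    (hfi k).aemeasurable.ennreal_ofReal) hlt
  filter_upwards [hae] with ω hω
  have h4 := ENNReal.tendsto_atTop_zero_of_tsum_ne_top hω.ne
  have h5 := (ENNReal.tendsto_toReal ENNReal.zero_ne_top).comp h4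
  have h6 : Tendsto (fun k => f k ω) atTop (𝓝 0) := by
    refine (h5.congr fun k => ?_)
    simp only [Function.comp]
    exact ENNReal.toReal_ofReal (sq_nonneg _)
  have h7 := h6.sqrt
  rw [Real.sqrt_zero] at h7
  refine (tendsto_zero_iff_abs_tendsto_zero _).2 (h7.congr fun k => ?_)
  simp only [hf, Real.sqrt_sq_eq_abs, Function.comp]

/-- A process with `S (n + 1) = S n + H (Z n) (W n)`, where `W n` is independent of
`(Z n, S n)` and `H z` has mean zero under the law of `W n`, has second moments growing at most
linearly. -/
theorem integral_sq_le_of_centered_increments {Ω E : Type*} [MeasurableSpace Ω]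
    [MeasurableSpace E] {P : Measure Ω} [IsProbabilityMeasure P] {ρ : Measure E} [SFinite ρ]
    {S Z : ℕ → Ω → ℝ} {W : ℕ → Ω → E} (hSm : ∀ n, Measurable (S n))
    (hZm : ∀ n, Measurable (Z n)) (hW : ∀ n, HasLaw (W n) ρ P)
    (hind : ∀ n, IndepFun (fun ω => (Z n ω, S n ω)) (W n) P)
    {H : ℝ → E → ℝ} (hHm : Measurable (Function.uncurry H))
    (hZ : ∀ n ω, 0 ≤ Z n ω)
    (hH0 : ∀ z, 0 ≤ z → ∫ w, H z w ∂ρ = 0) {B : E → ℝ} (hB : MemLp B 2 ρ)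
    (hHB : ∀ n, ∀ᵐ ω ∂P, |H (Z n ω) (W n ω)| ≤ B (W n ω))
    (hS : ∀ n ω, S (n + 1) ω = S n ω + H (Z n ω) (W n ω)) (hS0 : MemLp (S 0) 2 P) :
    (∀ n, MemLp (S n) 2 P) ∧
      ∀ n : ℕ, ∫ ω, S n ω ^ 2 ∂P ≤ (∫ ω, S 0 ω ^ 2 ∂P + ∫ w, B w ^ 2 ∂ρ) * (n + 1) := by
  have hWm : ∀ n, AEMeasurable (W n) P := fun n => (hW n).aemeasurable
  have hξm : ∀ n, AEMeasurable (fun ω => H (Z n ω) (W n ω)) P := fun n =>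
    hHm.comp_aemeasurable ((hZm n).aemeasurable.prodMk (hWm n))
  have hBW : ∀ n, MemLp (fun ω => B (W n ω)) 2 P := fun n => by
    have h1 : MemLp B 2 (P.map (W n)) := by rw [(hW n).map_eq]; exact hB
    exact h1.comp_of_map (hWm n)
  have hξ : ∀ n, MemLp (fun ω => H (Z n ω) (W n ω)) 2 P := fun n => by
    refine (hBW n).mono (hξm n).aestronglyMeasurable ?_
    filter_upwards [hHB n] with ω h
    exact h.trans (le_abs_self _)
  have hSL : ∀ n, MemLp (S n) 2 P := fun n => by
    induction n with
    | zero => exact hS0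
    | succ n ih =>
      have : S (n + 1) = fun ω => S n ω + H (Z n ω) (W n ω) := funext (hS n)
      rw [this]
      exact ih.add (hξ n)
  refine ⟨hSL, fun n => ?_⟩
  -- Orthogonality: by independence the joint law is a product, and Fubini integrates `H` over the
  -- fresh input first.
  have hcross : ∀ n, ∫ ω, S n ω * H (Z n ω) (W n ω) ∂P = 0 := fun n => by
    have hmeas : AEMeasurable (fun ω => ((Z n ω, S n ω), W n ω)) P :=
      ((hZm n).prodMk (hSm n)).aemeasurable.prodMk (hWm n)
    have hmap := (hind n).map_prod_eq_prod_map_map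
      ((hZm n).prodMk (hSm n)).aemeasurable (hWm n)
    rw [(hW n).map_eq] at hmap
    set Q := P.map (fun ω => (Z n ω, S n ω)) with hQ
    set K : (ℝ × ℝ) × E → ℝ := fun p => p.1.2 * H p.1.1 p.2 with hK
    have hKm : Measurable K :=
      (measurable_snd.comp measurable_fst).mul
        (hHm.comp ((measurable_fst.comp measurable_fst).prodMk measurable_snd))
    have hi : Integrable K (Q.prod ρ) := by
      rw [← hmap, integrable_map_measure hKm.aestronglyMeasurable hmeas]
      exact (hSL n).integrable_mul (hξ n)
    have h1 : ∫ ω, S n ω * H (Z n ω) (W n ω) ∂P = ∫ p, K p ∂(Q.prod ρ) := by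
      rw [← hmap, integral_map hmeas hKm.aestronglyMeasurable]
    have : IsProbabilityMeasure Q :=
      Measure.isProbabilityMeasure_map ((hZm n).prodMk (hSm n)).aemeasurable
    rw [h1, integral_prod _ hi]
    refine integral_eq_zero_of_ae ?_
    have hpos : ∀ᵐ q ∂Q, 0 ≤ q.1 := by
      rw [hQ, ae_map_iff ((hZm n).prodMk (hSm n)).aemeasurable
        (measurableSet_le measurable_const measurable_fst)]
      exact ae_of_all _ (hZ n)
    filter_upwards [hpos] with q hq
    simp only [hK]
    rw [integral_const_mul, hH0 _ hq, mul_zero, Pi.zero_apply]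
  have hBint : ∀ n, ∫ ω, H (Z n ω) (W n ω) ^ 2 ∂P ≤ ∫ w, B w ^ 2 ∂ρ := fun n => by
    have h1 : ∫ w, B w ^ 2 ∂ρ = ∫ ω, B (W n ω) ^ 2 ∂P :=
      ((hW n).integral_comp (f := fun w => B w ^ 2) (by
        exact (hB.1.pow 2))).symm
    rw [h1]
    refine integral_mono_ae (hξ n).integrable_sq (hBW n).integrable_sq ?_
    filter_upwards [hHB n] with ω h
    exact sq_le_sq' (by linarith [neg_abs_le (H (Z n ω) (W n ω))]) (by
      linarith [le_abs_self (H (Z n ω) (W n ω))])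
  have hB0 : 0 ≤ ∫ w, B w ^ 2 ∂ρ := integral_nonneg fun w => sq_nonneg _
  have hS00 : 0 ≤ ∫ ω, S 0 ω ^ 2 ∂P := integral_nonneg fun w => sq_nonneg _
  have key : ∀ n : ℕ, ∫ ω, S n ω ^ 2 ∂P ≤ ∫ ω, S 0 ω ^ 2 ∂P + n * ∫ w, B w ^ 2 ∂ρ := fun n => by
    induction n with
    | zero => simp
    | succ n ih =>
      have h1 : ∀ ω, S (n + 1) ω ^ 2 =
          S n ω ^ 2 + 2 * (S n ω * H (Z n ω) (W n ω)) + H (Z n ω) (W n ω) ^ 2 := fun ω => by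
        rw [hS]; ring
      have hi1 : Integrable (fun ω => S n ω ^ 2) P := (hSL n).integrable_sq
      have hi2 : Integrable (fun ω => S n ω * H (Z n ω) (W n ω)) P :=
        (hSL n).integrable_mul (hξ n)
      have hi3 : Integrable (fun ω => H (Z n ω) (W n ω) ^ 2) P := (hξ n).integrable_sq
      have hi4 : Integrable (fun ω => S n ω ^ 2 + 2 * (S n ω * H (Z n ω) (W n ω))) P :=
        hi1.add (hi2.const_mul 2)
      simp_rw [h1]
      rw [integral_add hi4 hi3, integral_add hi1 (hi2.const_mul 2), integral_const_mul, hcross]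
      push_cast
      linarith [hBint n]
  have := key n
  have hn : (0 : ℝ) ≤ n := n.cast_nonneg
  nlinarith [mul_nonneg hn hS00]

/-! ### Poisson equation and averages of the recursion. -/

/-- The almost sure limit of the averages of the recursion
`D (n + 1) = max (a n) (b n - D n)` with exponential inputs. -/
theorem ae_tendsto_average_max_sub {Ω : Type*} [MeasurableSpace Ω] {P : Measure Ω}
    [IsProbabilityMeasure P] {μ ν : ℝ} (hμ : 0 < μ) (hν : 0 < ν) {a b D : ℕ → Ω → ℝ}
    (ha0 : ∀ n ω, 0 ≤ a n ω) (hb0 : ∀ n ω, 0 ≤ b n ω) (hD0 : ∀ n ω, 0 ≤ D n ω)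
    (hDm : ∀ n, Measurable (D n))
    (hW : ∀ n, HasLaw (fun ω => (a n ω, b n ω)) ((expMeasure μ).prod (expMeasure ν)) P)
    (hind : ∀ n, IndepFun (fun ω => (D n ω, ∑ k ∈ Finset.range n, D (k + 1) ω))
      (fun ω => (a n ω, b n ω)) P)
    (hrec : ∀ n ω, D (n + 1) ω = max (a n ω) (b n ω - D n ω)) :
    ∀ᵐ ω ∂P, Tendsto (fun n : ℕ => (∑ k ∈ Finset.range n, D (k + 1) ω) / n) atTop
      (𝓝 ((2 * μ ^ 4 + 7 * μ ^ 3 * ν + 10 * μ ^ 2 * ν ^ 2 + 11 * μ * ν ^ 3 + 4 * ν ^ 4) /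
          (μ * ν * (μ + ν) ^ 2 * (3 * μ + 4 * ν)))) := by
  have := isProbabilityMeasure_expMeasure hμ
  have := isProbabilityMeasure_expMeasure hν
  set lam := (2 * μ ^ 4 + 7 * μ ^ 3 * ν + 10 * μ ^ 2 * ν ^ 2 + 11 * μ * ν ^ 3 + 4 * ν ^ 4) /
          (μ * ν * (μ + ν) ^ 2 * (3 * μ + 4 * ν)) with hlam
  -- The solution of the linear fixed-point equation `e2`; `e1` then identifies `lam`.
  set θ := 2 * μ * (μ + 2 * ν) / (ν * (μ + ν) * (3 * μ + 4 * ν)) with hθ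
  have hlam0 : 0 ≤ lam := by positivity
  have hθ0 : 0 ≤ θ := by positivity
  have e1 : 1 / μ + θ * (μ / (μ + ν)) = lam := by
    rw [hlam, hθ]; field_simp; ring
  have e2 : μ / (ν * (μ + ν)) - θ * μ / (2 * (μ + 2 * ν)) = θ := by
    rw [hθ]; field_simp; ring
  set ρ := (expMeasure μ).prod (expMeasure ν) with hρ
  set H : ℝ → ℝ × ℝ → ℝ := fun d w =>
    (max w.1 (w.2 - d) + θ * Real.exp (-(ν * max w.1 (w.2 - d)))) -
      (lam + θ * Real.exp (-(ν * d))) with hH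
  set B : ℝ × ℝ → ℝ := fun w => w.1 + w.2 + (lam + θ) with hBdef
  have hHm : Measurable (Function.uncurry H) := by
    simp only [hH, Function.uncurry_def]; fun_prop
  have hB : MemLp B 2 ρ := by
    have h1 : MemLp (fun w : ℝ × ℝ => w.1) 2 ρ := by
      have : MemLp (fun x : ℝ => x) 2 (ρ.map Prod.fst) := by
        rw [Measure.map_fst_prod]; simpa using memLp_two_id_expMeasure hμ
      exact this.comp_of_map measurable_fst.aemeasurable
    have h2 : MemLp (fun w : ℝ × ℝ => w.2) 2 ρ := by
      have : MemLp (fun x : ℝ => x) 2 (ρ.map Prod.snd) := by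
        rw [Measure.map_snd_prod]; simpa using memLp_two_id_expMeasure hν
      exact this.comp_of_map measurable_snd.aemeasurable
    exact (h1.add h2).add (memLp_const _)
  have hbound : ∀ d w, 0 ≤ d → 0 ≤ w.1 → 0 ≤ w.2 → |H d w| ≤ B w := fun d w hd h1 h2 => by
    have hm0 : 0 ≤ max w.1 (w.2 - d) := h1.trans (le_max_left _ _)
    have hm1 : max w.1 (w.2 - d) ≤ w.1 + w.2 := max_le (by linarith) (by linarith)
    have hexp : ∀ x, 0 ≤ x → 0 ≤ θ * Real.exp (-(ν * x)) ∧ θ * Real.exp (-(ν * x)) ≤ θ :=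
      fun x hx => ⟨by positivity, mul_le_of_le_one_right hθ0
        (Real.exp_le_one_iff.2 (by have := mul_nonneg hν.le hx; linarith))⟩
    have h3 := hexp _ hm0
    have h4 := hexp _ hd
    simp only [hH, hBdef]
    rw [abs_le]
    constructor <;> linarith
  have hae1 : ∀ᵐ w ∂ρ, 0 ≤ w.1 :=
    Measure.quasiMeasurePreserving_fst.ae (ae_nonneg_expMeasure μ)
  have hae2 : ∀ᵐ w ∂ρ, 0 ≤ w.2 :=
    Measure.quasiMeasurePreserving_snd.ae (ae_nonneg_expMeasure ν)
  have hH0 : ∀ d, 0 ≤ d → ∫ w, H d w ∂ρ = 0 := fun d hd => by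
    have hint : Integrable (H d) ρ := by
      refine (hB.integrable (by norm_num)).mono'
        (hHm.comp measurable_prodMk_left).aestronglyMeasurable ?_
      filter_upwards [hae1, hae2] with w h1 h2
      exact hbound d w hd h1 h2
    have hint' : Integrable (fun w : ℝ × ℝ =>
        max w.1 (w.2 - d) + θ * Real.exp (-(ν * max w.1 (w.2 - d)))) ρ := by
      refine (hint.add (integrable_const (lam + θ * Real.exp (-(ν * d))))).congr
        (ae_of_all _ fun w => ?_)
      simp [hH]
    simp only [hH]
    rw [integral_sub hint' (integrable_const _), integral_prod _ hint',
      integral_integral_max_expMeasure hμ hν hd, e1, e2]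
    simp
  set T : ℕ → Ω → ℝ := fun n ω => ∑ k ∈ Finset.range n, D (k + 1) ω with hT
  set S : ℕ → Ω → ℝ := fun n ω => T n ω - n * lam + θ * Real.exp (-(ν * D n ω)) with hS
  have hTm : ∀ n, Measurable (T n) := fun n =>
    Finset.measurable_fun_sum _ fun k _ => hDm (k + 1)
  have hSm : ∀ n, Measurable (S n) := fun n => by
    have := hTm n; have := hDm n
    simp only [hS]; fun_prop
  have hexp : ∀ n ω, θ * Real.exp (-(ν * D n ω)) ≤ θ := fun n ω =>
    mul_le_of_le_one_right hθ0 (Real.exp_le_one_iff.2 (by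
      have := mul_nonneg hν.le (hD0 n ω); linarith))
  have hind' : ∀ n, IndepFun (fun ω => (D n ω, S n ω)) (fun ω => (a n ω, b n ω)) P := fun n => by
    have hφ : Measurable fun p : ℝ × ℝ =>
        (p.1, p.2 - n * lam + θ * Real.exp (-(ν * p.1))) := by fun_prop
    exact (hind n).comp hφ measurable_id
  have hstep : ∀ n ω, S (n + 1) ω = S n ω + H (D n ω) (a n ω, b n ω) := fun n ω => by
    simp only [hS, hT, hH, Finset.sum_range_succ, ← hrec]
    push_cast
    ring
  have hS0 : MemLp (S 0) 2 P := by
    refine MemLp.of_bound (hSm 0).aestronglyMeasurable θ (ae_of_all _ fun ω => ?_)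
    have : 0 ≤ θ * Real.exp (-(ν * D 0 ω)) := by positivity
    simpa [hS, hT, abs_of_nonneg hθ0] using hexp 0 ω
  obtain ⟨hSL, hSC⟩ := integral_sq_le_of_centered_increments hSm hDm hW hind' hHm hD0 hH0 hB
    (fun n => ae_of_all _ fun ω => hbound _ _ (hD0 n ω) (ha0 n ω) (hb0 n ω)) hstep hS0
  filter_upwards [ae_tendsto_div_sq_of_integral_sq_le hSL hSC] with ω hω
  refine tendsto_div_of_monotone_of_exists_subseq_tendsto_div (fun n => T n ω) lam
    (monotone_nat_of_le_succ fun n => ?_) fun r hr => ⟨fun k => (k + 1) ^ 2, ?_, ?_, ?_⟩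
  · simp only [hT, Finset.sum_range_succ]
    linarith [hD0 (n + 1) ω]
  -- Ratios of consecutive squares tend to 1, hence are eventually below any `r > 1`.
  · have h1 : Tendsto (fun n : ℕ => (1 + 1 / ((n : ℝ) + 1)) ^ 2) atTop (𝓝 ((1 + 0) ^ 2)) :=
      (tendsto_const_nhds.add tendsto_one_div_add_atTop_nhds_zero_nat).pow 2
    filter_upwards [h1.eventually_lt_const (show (1 + 0 : ℝ) ^ 2 < r by linarith)] with n hn
    have h2 : (0 : ℝ) < (n : ℝ) + 1 := by positivity
    have h3 : (((n + 1 + 1) ^ 2 : ℕ) : ℝ) = (1 + 1 / ((n : ℝ) + 1)) ^ 2 * ((n + 1) ^ 2 : ℕ) := by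
      push_cast
      field_simp
    rw [h3]
    gcongr
  · exact (tendsto_pow_atTop two_ne_zero).comp (tendsto_add_atTop_nat 1)
  · have hc : Tendsto (fun k : ℕ => (k + 1) ^ 2) atTop atTop :=
      (tendsto_pow_atTop two_ne_zero).comp (tendsto_add_atTop_nat 1)
    have h1 : Tendsto (fun n : ℕ => θ * Real.exp (-(ν * D n ω)) / n) atTop (𝓝 0) :=
      squeeze_zero (fun n => by positivity)
        (fun n => div_le_div_of_nonneg_right (hexp n ω) n.cast_nonneg)
        (tendsto_const_div_atTop_nhds_zero_nat θ)
    have h2 := (hω.sub (h1.comp hc)).add_const lam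
    simp only [sub_zero, zero_add] at h2
    refine h2.congr fun k => ?_
    have hk : (((k + 1) ^ 2 : ℕ) : ℝ) ≠ 0 := by positivity
    simp only [hS, Function.comp]
    field_simp
    ring

/-- The recursion `D (n + 1) = max (α (n + m)) (β n - D n)` driven by independent exponential
sequences and started from a function of the first `m` terms of `α`. -/
theorem ae_tendsto_average_max_sub_of_iIndepFun {Ω : Type*} [MeasurableSpace Ω] {P : Measure Ω}
    [IsProbabilityMeasure P] {μ ν : ℝ} (hμ : 0 < μ) (hν : 0 < ν) {α β D : ℕ → Ω → ℝ}
    (hαm : ∀ n, Measurable (α n)) (hβm : ∀ n, Measurable (β n))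
    (hα0 : ∀ n ω, 0 ≤ α n ω) (hβ0 : ∀ n ω, 0 ≤ β n ω)
    (hα : ∀ n, HasLaw (α n) (expMeasure μ) P) (hβ : ∀ n, HasLaw (β n) (expMeasure ν) P)
    (hind : iIndepFun (Sum.elim α β : ℕ ⊕ ℕ → Ω → ℝ) P) (m : ℕ) (hD0 : ∀ ω, 0 ≤ D 0 ω)
    (hDm : Measurable[⨆ k < m, MeasurableSpace.comap (α k) inferInstance] (D 0))
    (hrec : ∀ n ω, D (n + 1) ω = max (α (n + m) ω) (β n ω - D n ω)) :
    ∀ᵐ ω ∂P, Tendsto (fun n : ℕ => (∑ k ∈ Finset.range n, D (k + 1) ω) / n) atTop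
      (𝓝 ((2 * μ ^ 4 + 7 * μ ^ 3 * ν + 10 * μ ^ 2 * ν ^ 2 + 11 * μ * ν ^ 3 + 4 * ν ^ 4) /
          (μ * ν * (μ + ν) ^ 2 * (3 * μ + 4 * ν)))) := by
  set X : ℕ ⊕ ℕ → Ω → ℝ := Sum.elim α β with hX
  have hXm : ∀ i, Measurable (X i) := by rintro (i | i); exacts [hαm i, hβm i]
  -- Inputs that may affect `D n`: the offset `m` gives `α` a head start, and `α (n + m)`, `β n`
  -- stay fresh.
  set past : ℕ → Set (ℕ ⊕ ℕ) := fun n => {i | Sum.elim (· < n + m) (· < n) i} with hpast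
  set F : ℕ → MeasurableSpace Ω := fun n =>
    ⨆ i ∈ past n, MeasurableSpace.comap (X i) inferInstance with hF
  have hFX : ∀ n, ∀ i ∈ past n, Measurable[F n] (X i) := fun n i hi =>
    (comap_measurable (X i)).mono
      (le_iSup₂ (f := fun i (_ : i ∈ past n) => MeasurableSpace.comap (X i) inferInstance) i hi)
      le_rfl
  have hFle : ∀ n, F n ≤ ‹MeasurableSpace Ω› := fun n =>
    iSup₂_le fun i _ => (hXm i).comap_le
  have hFmono : Monotone F := monotone_nat_of_le_succ fun n =>
    biSup_mono fun i hi => by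
      rcases i with i | i
      · exact (show i < n + m from hi).trans (by omega)
      · exact (show i < n from hi).trans (by omega)
  have hDF : ∀ n, Measurable[F n] (D n) := fun n => by
    induction n with
    | zero =>
      refine hDm.mono (iSup₂_le fun k hk => ?_) le_rfl
      exact (hFX 0 (Sum.inl k) (show k < 0 + m by omega)).comap_le
    | succ n ih =>
      have h0 : D (n + 1) = fun ω => max (α (n + m) ω) (β n ω - D n ω) := funext (hrec n)
      rw [h0]
      have h1 : Measurable[F (n + 1)] (α (n + m)) :=
        hFX (n + 1) (Sum.inl (n + m)) (show n + m < n + 1 + m by omega)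
      have h2 : Measurable[F (n + 1)] (β n) :=
        hFX (n + 1) (Sum.inr n) (show n < n + 1 by omega)
      exact h1.max (h2.sub (ih.mono (hFmono n.le_succ) le_rfl))
  have hTF : ∀ n, Measurable[F n] fun ω => ∑ k ∈ Finset.range n, D (k + 1) ω := fun n =>
    Finset.measurable_fun_sum _ fun k hk =>
      (hDF (k + 1)).mono (hFmono (by simpa using hk)) le_rfl
  refine ae_tendsto_average_max_sub hμ hν (a := fun n => α (n + m)) (b := β)
    (fun n => hα0 _) hβ0 (fun n ω => ?_) (fun n => (hDF n).mono (hFle n) le_rfl) (fun n => ?_)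
    (fun n => ?_) hrec
  · rcases n with _ | n
    · exact hD0 ω
    · rw [hrec]; exact (hα0 _ _).trans (le_max_left _ _)
  · have h1 : IndepFun (α (n + m)) (β n) P :=
      hind.indepFun (i := Sum.inl (n + m)) (j := Sum.inr n) (by simp)
    exact h1.hasLaw_prod (hα _) (hβ _)
  · have hdisj : Disjoint (past n) {Sum.inl (n + m), Sum.inr n} := by
      rw [Set.disjoint_right]
      rintro i (rfl | rfl) h
      · exact lt_irrefl (n + m) h
      · exact lt_irrefl n h
    have h1 := indep_iSup_of_disjoint (fun i => (hXm i).comap_le) hind.iIndep hdisj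
    have hG : ∀ i ∈ ({Sum.inl (n + m), Sum.inr n} : Set (ℕ ⊕ ℕ)),
        Measurable[⨆ i ∈ ({Sum.inl (n + m), Sum.inr n} : Set (ℕ ⊕ ℕ)),
          MeasurableSpace.comap (X i) inferInstance] (X i) := fun i hi =>
      (comap_measurable (X i)).mono
        (le_iSup₂ (f := fun i (_ : i ∈ ({Sum.inl (n + m), Sum.inr n} : Set (ℕ ⊕ ℕ))) =>
          MeasurableSpace.comap (X i) inferInstance) i hi) le_rfl
    rw [IndepFun_iff_Indep]
    refine indep_of_indep_of_le_left (indep_of_indep_of_le_right h1 ?_) ?_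
    · exact Measurable.comap_le (Measurable.prodMk (hG (Sum.inl (n + m)) (by simp))
        (hG (Sum.inr n) (by simp)))
    · exact Measurable.comap_le (Measurable.prodMk (hDF n) (hTF n))

/-! ### Reduction of the two systems to the recursion. -/

/-- A law controls a variable only almost everywhere; this modification lets the recursions and
measurability hold everywhere. -/
theorem HasLaw.exists_measurable_nonneg {Ω : Type*} [MeasurableSpace Ω] {P : Measure Ω} {r : ℝ}
    {X : ℕ → Ω → ℝ} (hX : ∀ n, HasLaw (X n) (expMeasure r) P) :
    ∃ Y : ℕ → Ω → ℝ, (∀ n, Measurable (Y n)) ∧ (∀ n ω, 0 ≤ Y n ω) ∧ (∀ n, Y n =ᵐ[P] X n) ∧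
      ∀ n, HasLaw (Y n) (expMeasure r) P := by
  have hY : ∀ n, (fun ω => max ((hX n).aemeasurable.mk (X n) ω) 0) =ᵐ[P] X n := fun n => by
    have h1 : ∀ᵐ ω ∂P, 0 ≤ X n ω := by
      refine ae_of_ae_map (hX n).aemeasurable (p := fun x => 0 ≤ x) ?_
      rw [(hX n).map_eq]
      exact ae_nonneg_expMeasure r
    filter_upwards [h1, (hX n).aemeasurable.ae_eq_mk] with ω h2 h3
    rw [← h3, max_eq_left h2]
  exact ⟨_, fun n => (hX n).aemeasurable.measurable_mk.max measurable_const,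
    fun n ω => le_max_right _ _, hY, fun n => (hX n).congr (hY n)⟩

theorem IsLyapunovExponent.congr {Ω : Type*} [MeasurableSpace Ω] {P : Measure Ω}
    {A A' : ℕ → Ω → Matrix (Fin 2) (Fin 2) ℝ} {lam : ℝ} (h : IsLyapunovExponent P A lam)
    (hA : ∀ k, A k =ᵐ[P] A' k) : IsLyapunovExponent P A' lam := by
  filter_upwards [h, ae_all_iff.2 hA] with ω h1 h2
  have h3 : ∀ k, stateVector A' k ω = stateVector A k ω := fun k => by
    induction k with
    | zero => rfl
    | succ k ih => simp only [stateVector, ih, h2]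
  simpa only [h3] using h1

theorem stateVector_firstRow {Ω : Type*} {α β : ℕ → Ω → ℝ} (hα : ∀ n ω, 0 ≤ α n ω)
    (hβ : ∀ n ω, 0 ≤ β n ω) {z : ℕ → Ω → Fin 2 → ℝ}
    (hz : z = stateVector fun k ω => !![α k ω, β k ω; 0, 0]) (n : ℕ) (ω : Ω) :
    z n ω 1 ≤ z n ω 0 ∧ z (n + 1) ω 0 - z (n + 1) ω 1 =
      max (α n ω) (β n ω - (z n ω 0 - z n ω 1)) ∧ z (n + 1) ω 1 = z n ω 0 := by
  have h0 : ∀ n, z (n + 1) ω 0 = max (z n ω 0 + α n ω) (z n ω 1 + β n ω) := fun n => by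
    simp [hz, stateVector, maxPlusMulVec]
  have h1 : ∀ n, z (n + 1) ω 1 = max (z n ω 0) (z n ω 1) := fun n => by
    simp [hz, stateVector, maxPlusMulVec]
  have hle : ∀ n, z n ω 1 ≤ z n ω 0 := fun n => by
    rcases n with _ | n
    · simp [hz, stateVector]
    · rw [h0, h1]
      exact max_le_max (by linarith [hα n ω]) (by linarith [hβ n ω])
  have h2 : z (n + 1) ω 1 = z n ω 0 := by rw [h1, max_eq_left (hle n)]
  refine ⟨hle n, ?_, h2⟩
  rw [h2, h0, ← max_sub_sub_right]
  congr 1 <;> ring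

theorem stateVector_firstColumn {Ω : Type*} {α γ : ℕ → Ω → ℝ} (hα : ∀ n ω, 0 ≤ α n ω)
    {z : ℕ → Ω → Fin 2 → ℝ}
    (hz : z = stateVector fun k ω => !![α k ω, 0; γ k ω, 0]) (n : ℕ) (ω : Ω) :
    z n ω 1 ≤ z (n + 1) ω 0 ∧ z n ω 0 ≤ z (n + 1) ω 0 ∧
      z (n + 2) ω 0 - z (n + 1) ω 0 =
        max (α (n + 1) ω) (γ n ω - (z (n + 1) ω 0 - z n ω 0)) := by
  have h0 : ∀ n, z (n + 1) ω 0 = max (z n ω 0 + α n ω) (z n ω 1) := fun n => by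
    simp [hz, stateVector, maxPlusMulVec]
  have h1 : ∀ n, z (n + 1) ω 1 = max (z n ω 0 + γ n ω) (z n ω 1) := fun n => by
    simp [hz, stateVector, maxPlusMulVec]
  have h2 : z n ω 1 ≤ z (n + 1) ω 0 := by rw [h0]; exact le_max_right _ _
  have h3 : z (n + 1) ω 0 ≤ z (n + 1) ω 0 + α (n + 1) ω := by linarith [hα (n + 1) ω]
  refine ⟨h2, ?_, ?_⟩
  · rw [h0]; exact le_max_of_le_left (by linarith [hα n ω])
  -- The old `y(n)` inside `y(n+1)` is absorbed, since it is at most `x(n+1) + α (n + 1)`.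
  · have h4 : z (n + 2) ω 0 = max (z (n + 1) ω 0 + α (n + 1) ω) (z n ω 0 + γ n ω) := by
      rw [h0, h1, max_comm (z n ω 0 + γ n ω), ← max_assoc, max_eq_left (h2.trans h3)]
    rw [h4, ← max_sub_sub_right]
    congr 1 <;> ring

theorem mainTheorem5 {Ω : Type*} [MeasurableSpace Ω] (P : Measure Ω) [IsProbabilityMeasure P]
    (μ : ℝ) (hμ : 0 < μ) (α : ℕ → Ω → ℝ) (hα : ∀ k, HasLaw (α k) (expMeasure μ) P) :
    (∀ (ν : ℝ) (β : ℕ → Ω → ℝ), 0 < ν →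
      (∀ k, HasLaw (β k) (expMeasure ν) P) →
      iIndepFun (Sum.elim α β : ℕ ⊕ ℕ → Ω → ℝ) P →
      IsLyapunovExponent P (fun k ω => !![α k ω, β k ω; 0, 0])
        ((2 * μ ^ 4 + 7 * μ ^ 3 * ν + 10 * μ ^ 2 * ν ^ 2 + 11 * μ * ν ^ 3 + 4 * ν ^ 4) /
          (μ * ν * (μ + ν) ^ 2 * (3 * μ + 4 * ν)))) ∧
    (∀ (σ : ℝ) (γ : ℕ → Ω → ℝ), 0 < σ →
      (∀ k, HasLaw (γ k) (expMeasure σ) P) →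
      iIndepFun (Sum.elim α γ : ℕ ⊕ ℕ → Ω → ℝ) P →
      IsLyapunovExponent P (fun k ω => !![α k ω, 0; γ k ω, 0])
        ((2 * μ ^ 4 + 7 * μ ^ 3 * σ + 10 * μ ^ 2 * σ ^ 2 + 11 * μ * σ ^ 3 + 4 * σ ^ 4) /
          (μ * σ * (μ + σ) ^ 2 * (3 * μ + 4 * σ)))) := by
  obtain ⟨α', hαm, hα0, hαe, hαl⟩ := HasLaw.exists_measurable_nonneg hα
  constructor
  · intro ν β hν hβ hind
    obtain ⟨β', hβm, hβ0, hβe, hβl⟩ := HasLaw.exists_measurable_nonneg hβ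
    have hind' : iIndepFun (Sum.elim α' β' : ℕ ⊕ ℕ → Ω → ℝ) P :=
      hind.congr (by rintro (k | k); exacts [(hαe k).symm, (hβe k).symm])
    refine IsLyapunovExponent.congr (A := fun k ω => !![α' k ω, β' k ω; 0, 0]) ?_ fun k => by
      filter_upwards [hαe k, hβe k] with ω h1 h2
      rw [h1, h2]
    obtain ⟨z, hz⟩ : ∃ z, z = stateVector fun k ω => !![α' k ω, β' k ω; 0, 0] := ⟨_, rfl⟩
    have hst := stateVector_firstRow hα0 hβ0 hz
    have hz0 : ∀ ω i, z 0 ω i = 0 := fun ω i => by simp [hz, stateVector]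
    have hD0 : (fun ω => z 0 ω 0 - z 0 ω 1) = fun _ => 0 := by
      ext ω; simp [hz0]
    filter_upwards [ae_tendsto_average_max_sub_of_iIndepFun hμ hν hαm hβm hα0 hβ0 hαl hβl hind' 0
      (D := fun n ω => z n ω 0 - z n ω 1) (fun ω => by simp [hz0])
      (by simp only [hD0]; exact measurable_const) (fun n ω => (hst n ω).2.1)] with ω hω
    rw [← hz]
    refine hω.congr fun n => ?_
    have hsum : ∑ k ∈ Finset.range n, (z (k + 1) ω 0 - z (k + 1) ω 1) = z n ω 0 := by
      simp_rw [fun k => (hst k ω).2.2]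
      rw [Finset.sum_range_sub (fun k => z k ω 0), hz0, sub_zero]
    rw [hsum, max_eq_left (hst n ω).1, one_div, div_eq_inv_mul]
  · intro σ γ hσ hγ hind
    obtain ⟨γ', hγm, hγ0, hγe, hγl⟩ := HasLaw.exists_measurable_nonneg hγ
    have hind' : iIndepFun (Sum.elim α' γ' : ℕ ⊕ ℕ → Ω → ℝ) P :=
      hind.congr (by rintro (k | k); exacts [(hαe k).symm, (hγe k).symm])
    refine IsLyapunovExponent.congr (A := fun k ω => !![α' k ω, 0; γ' k ω, 0]) ?_ fun k => by
      filter_upwards [hαe k, hγe k] with ω h1 h2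
      rw [h1, h2]
    obtain ⟨z, hz⟩ : ∃ z, z = stateVector fun k ω => !![α' k ω, 0; γ' k ω, 0] := ⟨_, rfl⟩
    have hst := stateVector_firstColumn hα0 hz
    have hz0 : ∀ ω i, z 0 ω i = 0 := fun ω i => by simp [hz, stateVector]
    -- The initial increment is already the first term of `α'`, hence `m = 1`.
    have hD0 : (fun ω => z (0 + 1) ω 0 - z 0 ω 0) = α' 0 := by
      ext ω; simp [hz, stateVector, maxPlusMulVec, hα0]
    filter_upwards [ae_tendsto_average_max_sub_of_iIndepFun hμ hσ hαm hγm hα0 hγ0 hαl hγl hind' 1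
      (D := fun n ω => z (n + 1) ω 0 - z n ω 0) (fun ω => by linarith [(hst 0 ω).2.1])
      (by
        simp only [hD0]
        exact (comap_measurable (α' 0)).mono (le_iSup₂ (f := fun k (_ : k < 1) =>
          MeasurableSpace.comap (α' k) inferInstance) 0 one_pos) le_rfl)
      (fun n ω => (hst n ω).2.2)] with ω hω
    rw [← hz]
    have hsum : ∀ n, ∑ k ∈ Finset.range n, (z (k + 1 + 1) ω 0 - z (k + 1) ω 0) =
        z (n + 1) ω 0 - z 1 ω 0 := fun n => Finset.sum_range_sub (fun k => z (k + 1) ω 0) n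
    simp_rw [hsum] at hω
    have hup := hω.add (tendsto_const_div_atTop_nhds_zero_nat (z 1 ω 0))
    simp only [← add_div, sub_add_cancel, add_zero] at hup
    have hlow : Tendsto (fun n : ℕ => z n ω 0 / n) atTop (𝓝 ((2 * μ ^ 4 + 7 * μ ^ 3 * σ +
        10 * μ ^ 2 * σ ^ 2 + 11 * μ * σ ^ 3 + 4 * σ ^ 4) /
          (μ * σ * (μ + σ) ^ 2 * (3 * μ + 4 * σ)))) := by
      rw [← tendsto_add_atTop_iff_nat 1]
      have h1 := hup.mul (tendsto_natCast_div_add_atTop (1 : ℝ))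
      rw [mul_one] at h1
      refine h1.congr' ?_
      filter_upwards [eventually_ne_atTop 0] with n hn
      have hn' : (n : ℝ) ≠ 0 := by exact_mod_cast hn
      push_cast
      field_simp
    -- Squeeze: the maximum lies between `x(n)` and `x(n+1)`.
    refine tendsto_of_tendsto_of_tendsto_of_le_of_le hlow hup (fun n => ?_) fun n => ?_
    · rw [one_div, ← div_eq_inv_mul]
      exact div_le_div_of_nonneg_right (le_max_left _ _) n.cast_nonneg
    · simp only [one_div, ← div_eq_inv_mul]
      exact div_le_div_of_nonneg_right (max_le (hst n ω).2.1 (hst n ω).1) n.cast_nonneg
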